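/- Let $n\ge 1$ and let $(M,\varphi,\xi,\eta,g)$ be a cosymplectic almost contact complex Riemannian manifold of dimension $2n+1$. That is, $M$ is a smooth manifold with smooth tensor fields $\varphi$ (an endomorphism of $TM$), $\xi$ (a vector field), $\eta$ (a 1-form) and a pseudo-Riemannian metric $g$ of signature $(n+1,n)$ such that $$\varphi\xi=0,\quad \varphi^2=-\iota+\eta\otimes\xi,\quad \eta\circ\varphi=0,\quad \eta(\xi)=1,\quad g(\varphi x,\varphi y)=-g(x,y)+\eta(x)\eta(y),$$ where $\iota$ is the identity, and $F(x,y,z)=g((\nabla_x\varphi)y,z)$ vanishes identically, where $\nabla$ is the Levi-Civita connection of $g$. Put $\tilde g(x,y)=g(x,\varphi y)+\eta(x)\eta(y)$. Let $u,v,w$ be smooth real functions on $M$, and let $$\bar\xi=e^{-w}\xi,\qquad \bar\eta=e^{w}\eta,\qquad \bar g=e^{2u}\cos 2v\, g+e^{2u}\sin 2v\,\tilde g+\left(e^{2w}-e^{2u}\cos 2v-e^{2u}\sin 2v\right)\eta\otimes\eta ;$$ the manifold $(M,\varphi,\bar\xi,\bar\eta,\bar g)$ so obtained is called a $G(\mathcal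 F_0)$-manifold. Suppose that $(\bar g,\bar\vartheta,\bar\sigma)$ is an almost Riemann soliton with vertical potential on it: $\bar\vartheta$ is a smooth vector field and $\bar\sigma$ a smooth function with $$2\bar R+\bar\sigma\,\bar g\owedge\bar g+\bar g\owedge\mathcal L_{\bar\vartheta}\bar g=0,$$ and $\bar\vartheta=\bar k\,\bar\xi$ for a smooth function $\bar k$ that vanishes nowhere. Here $\bar R(x,y,z,w)=\bar g(\bar R(x,y)z,w)$ with $\bar R(x,y)=[\bar\nabla_x,\bar\nabla_y]-\bar\nabla_{[x,y]}$ is the curvature tensor of the Levi-Civita connection $\bar\nabla$ of $\bar g$, and $$(h\owedge k)(x,y,z,w)=h(y,z)k(x,w)-h(x,z)k(y,w)+k(y,z)h(x,w)-k(x,z)h(y,w).$$ Let $\bar\rho(y,z)=\bar g^{ij}\bar R(e_i,y,z,e_j)$ be the Ricci tensor and $\bar\tau^*=\bar g^{ij}\bar\rho(e_i,\varphi e_j)$ the $*$-scalar curvature. Then $$\bar\tau^*=2n(2n-1)\,\bar k\,dv(\bar\xi)$$ on $M$. In particular, the $*$-scalar curvature $\bar\tau^*$ vanishes identically on $M$ if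 and only if $v$ is a vertical constant, i.e. $dv(\bar\xi)=0$ on $M$. -/

import Mathlib

open scoped Manifold ContDiff

noncomputable section

/-! ### Tensor calculus in an open subset of a normed space

In this part `G` is a field of bilinear forms (the components of a pseudo-Riemannian metric),
`Φ` a field of endomorphisms and `X` a vector field, all in the coordinates of a chart with values
in `E`.  The vectors `a b c : E` are read as constant (coordinate) vector fields. -/

namespace InChart

variable {E : Type*} [NormedAddCommGroup E] [NormedSpace ℝ E]

/-- The Christoffel symbol `Γ(a, b) = ∇_a b` of the Levi-Civita connection of `G`: the vector with
`G(Γ(a, b), c) = (1/2) * (∂_a G(b, c) + ∂_b G(a, c) - ∂_c G(a, b))` for all `c`. -/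
def christoffel (G : E → E →L[ℝ] E →L[ℝ] ℝ) (y a b : E) : E :=
  (G y).inverse ((1 / 2 : ℝ) •
    (fderiv ℝ G y a b + fderiv ℝ G y b a - ((fderiv ℝ G y).flip a).flip b))

/-- The covariant derivative `(∇_a Φ) b` of a field of endomorphisms. -/
def covDerivEndo (G : E → E →L[ℝ] E →L[ℝ] ℝ) (Φ : E → E →L[ℝ] E) (y a b : E) : E :=
  fderiv ℝ Φ y a b + christoffel G y a (Φ y b) - Φ y (christoffel G y a b)

/-- The curvature `R(a, b) c = ∇_a ∇_b c - ∇_b ∇_a c` (coordinate fields commute). -/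
def curvature (G : E → E →L[ℝ] E →L[ℝ] ℝ) (y a b c : E) : E :=
  fderiv ℝ (fun z => christoffel G z b c) y a - fderiv ℝ (fun z => christoffel G z a c) y b
    + christoffel G y a (christoffel G y b c) - christoffel G y b (christoffel G y a c)

/-- The Lie derivative `(L_X G)(a, b) = X (G(a, b)) - G([X, a], b) - G(a, [X, b])`, where
`[X, a] = - ∂_a X` since `a` is constant. -/
def lieDerivForm (G : E → E →L[ℝ] E →L[ℝ] ℝ) (X : E → E) (y a b : E) : ℝ :=
  fderiv ℝ G y (X y) a b + G y (fderiv ℝ X y a) b + G y a (fderiv ℝ X y b)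

end InChart

/-! ### Multilinear algebra -/

/-- The Kulkarni-Nomizu product of two symmetric bilinear forms. -/
def kulkarniNomizu {V : Type*} (h k : V → V → ℝ) (x y z w : V) : ℝ :=
  h y z * k x w - h x z * k y w + k y z * h x w - k x z * h y w

/-- The trace `g^{ij} B(e_i, e_j)` of `B` with respect to the nondegenerate form `g`, where
`e_1, …, e_d` is the standard basis and `(g^{ij})` is the inverse of the matrix `(g(e_i, e_j))`. -/
def metricTrace {d : ℕ}
    (g : EuclideanSpace ℝ (Fin d) →L[ℝ] EuclideanSpace ℝ (Fin d) →L[ℝ] ℝ)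
    (B : EuclideanSpace ℝ (Fin d) → EuclideanSpace ℝ (Fin d) → ℝ) : ℝ :=
  ∑ i, ∑ j, (Matrix.of fun i j : Fin d =>
      g (EuclideanSpace.single i (1 : ℝ)) (EuclideanSpace.single j (1 : ℝ)))⁻¹ i j *
    B (EuclideanSpace.single i (1 : ℝ)) (EuclideanSpace.single j (1 : ℝ))

/-! ### Tensor fields on a manifold

`M` is a `d`-dimensional manifold.  In Mathlib the tangent space at `p` is the model space
`EuclideanSpace ℝ (Fin d)`, a vector being given by its components in the preferred chart
`extChartAt (𝓡 d) p` (the derivative of this chart at `p` is the identity,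
see `mfderiv_extChartAt_self`).  Since they are tensors, the value at `p` of the curvature, of a covariant derivative or
of a Lie derivative is computed in the preferred chart at `p`. -/

namespace TensorField

variable {d : ℕ} {M : Type*} [TopologicalSpace M] [ChartedSpace (EuclideanSpace ℝ (Fin d)) M]

/-- The derivative at `y` of the inverse of the preferred chart at `p`: it sends a coordinate vector
to the tangent vector at the point `(extChartAt (𝓡 d) p).symm y` with these coordinates. -/
def chartFrame (M : Type*) [TopologicalSpace M] [ChartedSpace (EuclideanSpace ℝ (Fin d)) M]
    (p : M) (y : EuclideanSpace ℝ (Fin d)) :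
    EuclideanSpace ℝ (Fin d) →L[ℝ] EuclideanSpace ℝ (Fin d) :=
  mfderiv 𝓘(ℝ, EuclideanSpace ℝ (Fin d)) (𝓡 d) (extChartAt (𝓡 d) p).symm y

/-- The derivative of the preferred chart at `p`, at the point with coordinates `y`: it sends a
tangent vector at that point to its coordinates in this chart. -/
def chartCoframe (M : Type*) [TopologicalSpace M] [ChartedSpace (EuclideanSpace ℝ (Fin d)) M]
    (p : M) (y : EuclideanSpace ℝ (Fin d)) :
    EuclideanSpace ℝ (Fin d) →L[ℝ] EuclideanSpace ℝ (Fin d) :=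
  mfderiv (𝓡 d) 𝓘(ℝ, EuclideanSpace ℝ (Fin d)) (extChartAt (𝓡 d) p)
    ((extChartAt (𝓡 d) p).symm y)

/-- Components of a field of bilinear forms in the preferred chart at `p`, that is, its pullback
under the inverse of the chart. -/
def formInChart
    (g : ∀ q : M, TangentSpace (𝓡 d) q →L[ℝ] TangentSpace (𝓡 d) q →L[ℝ] ℝ) (p : M)
    (y : EuclideanSpace ℝ (Fin d)) :
    EuclideanSpace ℝ (Fin d) →L[ℝ] EuclideanSpace ℝ (Fin d) →L[ℝ] ℝ :=
  let B : EuclideanSpace ℝ (Fin d) →L[ℝ] EuclideanSpace ℝ (Fin d) →L[ℝ] ℝ :=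
    g ((extChartAt (𝓡 d) p).symm y)
  B.bilinearComp (chartFrame M p y) (chartFrame M p y)

/-- Components of a field of endomorphisms of the tangent spaces in the preferred chart at `p`. -/
def endoInChart (φ : ∀ q : M, TangentSpace (𝓡 d) q →L[ℝ] TangentSpace (𝓡 d) q) (p : M)
    (y : EuclideanSpace ℝ (Fin d)) : EuclideanSpace ℝ (Fin d) →L[ℝ] EuclideanSpace ℝ (Fin d) :=
  let A : EuclideanSpace ℝ (Fin d) →L[ℝ] EuclideanSpace ℝ (Fin d) :=
    φ ((extChartAt (𝓡 d) p).symm y)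
  chartCoframe M p y ∘L A ∘L chartFrame M p y

/-- Components of a vector field in the preferred chart at `p`. -/
def vectorInChart (X : ∀ q : M, TangentSpace (𝓡 d) q) (p : M)
    (y : EuclideanSpace ℝ (Fin d)) : EuclideanSpace ℝ (Fin d) :=
  chartCoframe M p y (X ((extChartAt (𝓡 d) p).symm y))

/-- The tensor `F(x, y, z) = g((∇_x φ) y, z)`, with `∇` the Levi-Civita connection of `g`. -/
def fundamentalTensor (φ : ∀ q : M, TangentSpace (𝓡 d) q →L[ℝ] TangentSpace (𝓡 d) q)
    (g : ∀ q : M, TangentSpace (𝓡 d) q →L[ℝ] TangentSpace (𝓡 d) q →L[ℝ] ℝ)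
    (p : M) (x y z : TangentSpace (𝓡 d) p) : ℝ :=
  g p (InChart.covDerivEndo (E := EuclideanSpace ℝ (Fin d)) (formInChart g p) (endoInChart φ p)
    (extChartAt (𝓡 d) p p) x y) z

/-- The curvature tensor `R(x, y, z, w) = g(R(x, y) z, w)` of the Levi-Civita connection of `g`,
with `R(x, y) = [∇_x, ∇_y] - ∇_{[x, y]}`. -/
def riemannTensor (g : ∀ q : M, TangentSpace (𝓡 d) q →L[ℝ] TangentSpace (𝓡 d) q →L[ℝ] ℝ)
    (p : M) (x y z w : TangentSpace (𝓡 d) p) : ℝ :=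
  g p (InChart.curvature (E := EuclideanSpace ℝ (Fin d)) (formInChart g p)
    (extChartAt (𝓡 d) p p) x y z) w

/-- The Lie derivative `(L_X g)(x, y)`. -/
def lieDerivative (X : ∀ q : M, TangentSpace (𝓡 d) q)
    (g : ∀ q : M, TangentSpace (𝓡 d) q →L[ℝ] TangentSpace (𝓡 d) q →L[ℝ] ℝ)
    (p : M) (x y : TangentSpace (𝓡 d) p) : ℝ :=
  InChart.lieDerivForm (formInChart g p) (vectorInChart X p) (extChartAt (𝓡 d) p p) x y

/-- The Ricci tensor `ρ(y, z) = g^{ij} R(e_i, y, z, e_j)`. -/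
def ricciTensor (g : ∀ q : M, TangentSpace (𝓡 d) q →L[ℝ] TangentSpace (𝓡 d) q →L[ℝ] ℝ)
    (p : M) (y z : TangentSpace (𝓡 d) p) : ℝ :=
  metricTrace (g p) (fun a b => riemannTensor g p a y z b)

/-- The `*`-scalar curvature `τ^* = g^{ij} φ^k_j ρ_{ik} = g^{ij} ρ(e_i, φ e_j)`. -/
def starScalarCurvature (φ : ∀ q : M, TangentSpace (𝓡 d) q →L[ℝ] TangentSpace (𝓡 d) q)
    (g : ∀ q : M, TangentSpace (𝓡 d) q →L[ℝ] TangentSpace (𝓡 d) q →L[ℝ] ℝ) (p : M) : ℝ :=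
  metricTrace (g p) (fun a b => ricciTensor g p a (φ p b))

/-- `(g, ϑ, σ)` is an almost Riemann soliton with potential `ϑ` and soliton function `σ`:
`2 R + σ g ⊼ g + g ⊼ L_ϑ g = 0`. -/
structure IsAlmostRiemannSoliton [IsManifold (𝓡 d) ∞ M]
    (g : ∀ q : M, TangentSpace (𝓡 d) q →L[ℝ] TangentSpace (𝓡 d) q →L[ℝ] ℝ)
    (ϑ : ∀ q : M, TangentSpace (𝓡 d) q) (σ : M → ℝ) : Prop where
  smooth_potential : ContMDiff (𝓡 d) ((𝓡 d).prod 𝓘(ℝ, EuclideanSpace ℝ (Fin d))) ∞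
    (fun q => Bundle.TotalSpace.mk' (EuclideanSpace ℝ (Fin d))
      (E := fun q : M => TangentSpace (𝓡 d) q) q (ϑ q))
  smooth_function : ContMDiff (𝓡 d) 𝓘(ℝ, ℝ) ∞ σ
  soliton_eq : ∀ (p : M) (x y z w : TangentSpace (𝓡 d) p),
    2 * riemannTensor g p x y z w
      + σ p * kulkarniNomizu (fun a b => g p a b) (fun a b => g p a b) x y z w
      + kulkarniNomizu (fun a b => g p a b) (lieDerivative ϑ g p) x y z w = 0

/-- The value `df(x)` of the differential of a real function at a tangent vector. -/
def differential (f : M → ℝ) (p : M) (x : TangentSpace (𝓡 d) p) : ℝ :=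
  mfderiv (𝓡 d) 𝓘(ℝ, ℝ) f p x

end TensorField

/-! ### Almost contact complex Riemannian structures -/

/-- A quadruple of tensor fields `(φ, ξ, η, g)` on a `(2 n + 1)`-dimensional manifold, of the types
of an almost contact B-metric structure (no relation between them is required here). -/
structure AccRTensors (n : ℕ) (M : Type*) [TopologicalSpace M]
    [ChartedSpace (EuclideanSpace ℝ (Fin (2 * n + 1))) M] where
  φ : ∀ p : M, TangentSpace (𝓡 (2 * n + 1)) p →L[ℝ] TangentSpace (𝓡 (2 * n + 1)) p
  ξ : ∀ p : M, TangentSpace (𝓡 (2 * n + 1)) p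
  η : ∀ p : M, TangentSpace (𝓡 (2 * n + 1)) p →L[ℝ] ℝ
  g : ∀ p : M, TangentSpace (𝓡 (2 * n + 1)) p →L[ℝ] TangentSpace (𝓡 (2 * n + 1)) p →L[ℝ] ℝ

namespace AccRTensors

variable {n : ℕ} {M : Type*} [TopologicalSpace M]
  [ChartedSpace (EuclideanSpace ℝ (Fin (2 * n + 1))) M]

/-- `(φ, ξ, η, g)` is an almost contact complex Riemannian (almost contact B-metric) structure:
smooth tensor fields, `g` a pseudo-Riemannian metric of signature `(n + 1, n)`, with
`φ ξ = 0`, `φ² = -ι + η ⊗ ξ`, `η ∘ φ = 0`, `η(ξ) = 1`, `g(φ x, φ y) = -g(x, y) + η(x) η(y)`. -/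
structure IsAccR [IsManifold (𝓡 (2 * n + 1)) ∞ M] (S : AccRTensors n M) : Prop where
  smooth_φ : ContMDiff (𝓡 (2 * n + 1))
    ((𝓡 (2 * n + 1)).prod 𝓘(ℝ, EuclideanSpace ℝ (Fin (2 * n + 1)) →L[ℝ]
      EuclideanSpace ℝ (Fin (2 * n + 1)))) ∞
    (fun p => Bundle.TotalSpace.mk' (EuclideanSpace ℝ (Fin (2 * n + 1)) →L[ℝ]
        EuclideanSpace ℝ (Fin (2 * n + 1)))
      (E := fun p : M => TangentSpace (𝓡 (2 * n + 1)) p →L[ℝ] TangentSpace (𝓡 (2 * n + 1)) p)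
      p (S.φ p))
  smooth_ξ : ContMDiff (𝓡 (2 * n + 1))
    ((𝓡 (2 * n + 1)).prod 𝓘(ℝ, EuclideanSpace ℝ (Fin (2 * n + 1)))) ∞
    (fun p => Bundle.TotalSpace.mk' (EuclideanSpace ℝ (Fin (2 * n + 1)))
      (E := fun p : M => TangentSpace (𝓡 (2 * n + 1)) p) p (S.ξ p))
  smooth_η : ContMDiff (𝓡 (2 * n + 1))
    ((𝓡 (2 * n + 1)).prod 𝓘(ℝ, EuclideanSpace ℝ (Fin (2 * n + 1)) →L[ℝ] ℝ)) ∞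
    (fun p => Bundle.TotalSpace.mk' (EuclideanSpace ℝ (Fin (2 * n + 1)) →L[ℝ] ℝ)
      (E := fun p : M => TangentSpace (𝓡 (2 * n + 1)) p →L[ℝ] Bundle.Trivial M ℝ p) p (S.η p))
  smooth_g : ContMDiff (𝓡 (2 * n + 1))
    ((𝓡 (2 * n + 1)).prod 𝓘(ℝ, EuclideanSpace ℝ (Fin (2 * n + 1)) →L[ℝ]
      EuclideanSpace ℝ (Fin (2 * n + 1)) →L[ℝ] ℝ)) ∞
    (fun p => Bundle.TotalSpace.mk' (EuclideanSpace ℝ (Fin (2 * n + 1)) →L[ℝ]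
        EuclideanSpace ℝ (Fin (2 * n + 1)) →L[ℝ] ℝ)
      (E := fun p : M => TangentSpace (𝓡 (2 * n + 1)) p →L[ℝ]
        TangentSpace (𝓡 (2 * n + 1)) p →L[ℝ] Bundle.Trivial M ℝ p) p (S.g p))
  φ_ξ : ∀ p, S.φ p (S.ξ p) = 0
  φ_φ : ∀ p x, S.φ p (S.φ p x) = -x + S.η p x • S.ξ p
  η_φ : ∀ p x, S.η p (S.φ p x) = 0
  η_ξ : ∀ p, S.η p (S.ξ p) = 1
  g_φ_φ : ∀ p x y, S.g p (S.φ p x) (S.φ p y) = -S.g p x y + S.η p x * S.η p y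
  symm_g : ∀ p x y, S.g p x y = S.g p y x
  sigPos_g : ∀ p, sigPos (LinearMap.BilinMap.toQuadraticMap
    (ContinuousLinearMap.toBilinForm (S.g p))) = n + 1
  sigNeg_g : ∀ p, sigNeg (LinearMap.BilinMap.toQuadraticMap
    (ContinuousLinearMap.toBilinForm (S.g p))) = n

/-- `(M, φ, ξ, η, g)` is cosymplectic, i.e. an `F₀`-manifold: an almost contact complex Riemannian
manifold with `F = 0`. -/
structure IsF0 [IsManifold (𝓡 (2 * n + 1)) ∞ M] (S : AccRTensors n M) : Prop extends
    S.IsAccR where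
  F_eq_zero : ∀ p x y z, TensorField.fundamentalTensor S.φ S.g p x y z = 0

/-- The associated B-metric `g̃(x, y) = g(x, φ y) + η(x) η(y)`. -/
def associated (S : AccRTensors n M) (p : M) :
    TangentSpace (𝓡 (2 * n + 1)) p →L[ℝ] TangentSpace (𝓡 (2 * n + 1)) p →L[ℝ] ℝ :=
  (ContinuousLinearMap.precomp ℝ (S.φ p)) ∘L (S.g p) + (S.η p).smulRight (S.η p)

/-- The contact conformal transformation (`G`-transformation) given by the functions `u, v, w`:
`φ` is kept, `ξ̄ = e^{-w} ξ`, `η̄ = e^w η` and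
`ḡ = e^{2u} cos 2v g + e^{2u} sin 2v g̃ + (e^{2w} - e^{2u} cos 2v - e^{2u} sin 2v) η ⊗ η`. -/
def gTransform (S : AccRTensors n M) (u v w : M → ℝ) : AccRTensors n M where
  φ := S.φ
  ξ p := Real.exp (-w p) • S.ξ p
  η p := Real.exp (w p) • S.η p
  g p := (Real.exp (2 * u p) * Real.cos (2 * v p)) • S.g p
    + (Real.exp (2 * u p) * Real.sin (2 * v p)) • S.associated p
    + (Real.exp (2 * w p) - Real.exp (2 * u p) * Real.cos (2 * v p)
        - Real.exp (2 * u p) * Real.sin (2 * v p)) • (S.η p).smulRight (S.η p)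

/-- The potential `ϑ` is vertical and nowhere degenerate: `ϑ = k ξ` for a smooth nowhere vanishing
function `k`. -/
structure IsVerticalPotential (S : AccRTensors n M)
    (ϑ : ∀ p : M, TangentSpace (𝓡 (2 * n + 1)) p) (k : M → ℝ) : Prop where
  smooth_k : ContMDiff (𝓡 (2 * n + 1)) 𝓘(ℝ, ℝ) ∞ k
  k_ne_zero : ∀ p, k p ≠ 0
  eq_smul : ∀ p, ϑ p = k p • S.ξ p

end AccRTensors

end

/-! The soliton equation expresses the curvature of the transformed metric algebraically through
that metric and its Lie derivative `L`, so no curvature is ever computed. Write `L(a, b) = ḡ(a, Λ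
b)` and let `d` be the dimension. One contraction gives a Ricci operator `-(d - 2)/2 Λ` plus a
multiple of the identity. Since `φ³ = -φ` forces `tr φ = 0`, the second contraction leaves `τ* = -(d
- 2)/2 tr(Λ φ)`, which is `metricTrace_metricTrace_of_kulkarniNomizu`.

It remains to find `Λ φ`. In the cosymplectic structure `ξ` is parallel, hence Killing for `g` and
an infinitesimal symmetry of `φ`. Along `f ξ` the Lie derivative of `ḡ` therefore only
differentiates its coefficients and adds terms in `df` (`lieDerivForm_smul`). The coefficients of
`g` and `g(·, φ·)` are the real and imaginary parts of `e^{2(u + iv)}`, with `φ` acting as `i` on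
`ker η`. Thus `Λ φ = 2f (du(ξ) φ + dv(ξ) φ²)` plus a trace-free operator of rank at most one. As `tr
φ² = -2n`, the trace is `-4n f dv(ξ)`. With `d = 2n + 1` and `f = k e^{-w}` this is the formula. -/

/-! ### Linear algebra of nondegenerate bilinear forms -/

section BilinearForms

variable {E : Type*} [NormedAddCommGroup E] [NormedSpace ℝ E] [FiniteDimensional ℝ E]

/-- A bilinear form whose signature exhausts the dimension is nondegenerate. -/
lemma nondegenerate_of_sigPos_add_sigNeg (g : E →L[ℝ] E →L[ℝ] ℝ)
    (hsymm : ∀ x y, g x y = g y x)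
    (hsig : sigPos (LinearMap.BilinMap.toQuadraticMap (ContinuousLinearMap.toBilinForm g))
      + sigNeg (LinearMap.BilinMap.toQuadraticMap (ContinuousLinearMap.toBilinForm g))
      = Module.finrank ℝ E)
    (x : E) (hx : ∀ y, g x y = 0) : x = 0 := by
  set Q := LinearMap.BilinMap.toQuadraticMap (ContinuousLinearMap.toBilinForm g) with hQ
  have h0 : Module.finrank ℝ Q.radical = 0 := by
    have := QuadraticForm.sigPos_add_sigNeg_add_radical (Q := Q)
    omega
  have hx' : x ∈ Q.radical := by
    rw [QuadraticMap.mem_radical_iff']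
    refine ⟨?_, fun y => ?_⟩
    · simp [hQ, hx]
    · simp [hQ, hx, hsymm y x]
  rw [Submodule.finrank_eq_zero.mp h0] at hx'
  simpa using hx'

/-- The map into the dual is injective between spaces of equal finite dimension. Invertibility
matters because `christoffel` uses `ContinuousLinearMap.inverse`, which is `0` on noninvertible
maps. -/
lemma isInvertible_of_nondegenerate (g : E →L[ℝ] E →L[ℝ] ℝ)
    (hg : ∀ x, (∀ y, g x y = 0) → x = 0) : g.IsInvertible := by
  have hinj : Function.Injective (g : E →ₗ[ℝ] E →L[ℝ] ℝ) := by
    rw [← LinearMap.ker_eq_bot, LinearMap.ker_eq_bot']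
    intro x hx
    refine hg x fun y => ?_
    have := congrArg (fun f : E →L[ℝ] ℝ => f y) hx
    simpa using this
  have hdim : Module.finrank ℝ E = Module.finrank ℝ (E →L[ℝ] ℝ) := by
    rw [← (LinearMap.toContinuousLinearMap (𝕜 := ℝ) (E := E) (F' := ℝ)).finrank_eq]
    exact (Subspace.dual_finrank_eq (K := ℝ) (V := E)).symm
  exact ⟨(LinearEquiv.ofInjectiveOfFinrankEq (g : E →ₗ[ℝ] E →L[ℝ] ℝ) hinj
    hdim).toContinuousLinearEquiv, rfl⟩

omit [FiniteDimensional ℝ E] in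
lemma ContinuousLinearMap.IsInvertible.apply_inverse_apply {g : E →L[ℝ] E →L[ℝ] ℝ}
    (hg : g.IsInvertible) (ℓ : E →L[ℝ] ℝ) : g (g.inverse ℓ) = ℓ :=
  (hg.inverse_apply_eq.mp rfl).symm

omit [FiniteDimensional ℝ E] in
lemma eq_of_forall_form_eq {g : E →L[ℝ] E →L[ℝ] ℝ} (hsymm : ∀ x y, g x y = g y x)
    (hg : ∀ x, (∀ y, g x y = 0) → x = 0) {x y : E} (h : ∀ a, g a x = g a y) : x = y := by
  rw [← sub_eq_zero]
  refine hg _ fun a => ?_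
  rw [hsymm, map_sub, h, sub_self]

/-- Every bilinear form is represented by an operator, with respect to a nondegenerate one. -/
lemma exists_operator_of_nondegenerate {g : E →L[ℝ] E →L[ℝ] ℝ} (hsymm : ∀ x y, g x y = g y x)
    (hg : ∀ x, (∀ y, g x y = 0) → x = 0) (B : E →L[ℝ] E →L[ℝ] ℝ) :
    ∃ T : E →ₗ[ℝ] E, ∀ a b, B a b = g a (T b) := by
  refine ⟨(g.inverse ∘L B.flip : E →L[ℝ] E), fun a b => ?_⟩
  rw [hsymm]
  simp [(isInvertible_of_nondegenerate g hg).apply_inverse_apply]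

/-- An endomorphism with `J³ = -J` of a real vector space is trace free. -/
lemma LinearMap.trace_eq_zero_of_cube_eq_neg (J : E →ₗ[ℝ] E) (hJ : J ^ 3 = -J) :
    LinearMap.trace ℝ E J = 0 := by
  let b := Module.finBasis ℝ E
  set A := LinearMap.toMatrix b b J with hA
  have hA3 : A ^ 3 = -A := by rw [hA, LinearMap.toMatrix_pow, hJ, map_neg]
  rw [LinearMap.trace_eq_matrix_trace ℝ b, ← hA]
  set C := A.map (algebraMap ℝ ℂ) with hC
  have hC3 : C ^ 3 = -C := by
    rw [hC, ← Matrix.map_pow, hA3]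
    ext; simp
  have htr : C.trace = ((A.trace : ℝ) : ℂ) := by
    simp [hC, Matrix.trace]
  -- Every complex eigenvalue satisfies `μ³ = -μ`, so it is `0` or `±i`. The trace is real and is
  -- the sum of these numbers, so it vanishes.
  have hre : ∀ μ ∈ C.charpoly.roots, μ.re = 0 := by
    intro μ hμ
    have hroot : C.charpoly.IsRoot μ := (Polynomial.mem_roots'.mp hμ).2
    rw [← Matrix.charpoly_toLin', ← Module.End.hasEigenvalue_iff_isRoot_charpoly] at hroot
    obtain ⟨x, hx⟩ := hroot.exists_hasEigenvector
    have h1 : (Matrix.toLin' C ^ 3) x = μ ^ 3 • x := hx.pow_apply 3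
    rw [← Matrix.toLin'_pow, hC3, map_neg, LinearMap.neg_apply, hx.apply_eq_smul,
      ← neg_smul] at h1
    have h2 : μ * (μ ^ 2 + 1) = 0 := by
      have := smul_left_injective ℂ hx.2 h1
      linear_combination -this
    rcases mul_eq_zero.mp h2 with h | h
    · simp [h]
    · have h3 := congrArg Complex.re h
      have h4 := congrArg Complex.im h
      simp [pow_two] at h3 h4
      rcases h4 with h4
      nlinarith
  have hsum : (C.charpoly.roots.sum).re = 0 := by
    change Complex.reAddGroupHom _ = 0
    rw [map_multiset_sum]
    refine Multiset.sum_eq_zero fun x hx => ?_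
    obtain ⟨μ, hμ, rfl⟩ := Multiset.mem_map.mp hx
    exact hre μ hμ
  rw [← Matrix.trace_eq_sum_roots_charpoly, htr] at hsum
  simpa using hsum

end BilinearForms

/-! ### Contractions with a nondegenerate metric -/

section MetricTrace

variable {d : ℕ} {g : EuclideanSpace ℝ (Fin d) →L[ℝ] EuclideanSpace ℝ (Fin d) →L[ℝ] ℝ}

/-- With Gram matrix `A`, the form `g(·, T ·)` has matrix `A T`, and contracting with `A⁻¹` returns
`tr T`. -/
lemma metricTrace_eq_trace (hsymm : ∀ x y, g x y = g y x)
    (hg : ∀ x, (∀ y, g x y = 0) → x = 0)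
    (T : EuclideanSpace ℝ (Fin d) →ₗ[ℝ] EuclideanSpace ℝ (Fin d)) :
    metricTrace g (fun a b => g a (T b)) = LinearMap.trace ℝ _ T := by
  let b := (EuclideanSpace.basisFun (Fin d) ℝ).toBasis
  have hb : ∀ i, b i = EuclideanSpace.single i (1 : ℝ) := fun i => by simp [b]
  set A : Matrix (Fin d) (Fin d) ℝ := Matrix.of fun i j =>
    g (EuclideanSpace.single i (1 : ℝ)) (EuclideanSpace.single j (1 : ℝ)) with hA
  have hAt : A.transpose = A := by ext i j; simp [hA, hsymm]
  have hexp : ∀ i x, g (EuclideanSpace.single i (1 : ℝ)) x = ∑ k, A i k * x k := by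
    intro i x
    conv_lhs => rw [← b.sum_repr x]
    rw [map_sum]
    refine Finset.sum_congr rfl fun k _ => ?_
    rw [hb, map_smul, smul_eq_mul, mul_comm]
    simp [hA, b]
  have hdet : IsUnit A.det := by
    rw [isUnit_iff_ne_zero]
    intro h0
    obtain ⟨x, hx0, hx⟩ := Matrix.exists_mulVec_eq_zero_iff.mpr h0
    apply hx0
    have : WithLp.toLp 2 x = (0 : EuclideanSpace ℝ (Fin d)) := by
      refine hg _ fun y => ?_
      rw [hsymm, ← b.sum_repr y]
      simp only [map_sum, map_smul, FunLike.coe_sum, Finset.sum_apply, smul_apply, hb, hexp]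
      refine Finset.sum_eq_zero fun i _ => ?_
      have := congrFun hx i
      simp only [Matrix.mulVec, dotProduct, Pi.zero_apply] at this
      simp [this]
    simpa using congrArg WithLp.ofLp this
  have hmul : ∀ i j, g (EuclideanSpace.single i (1 : ℝ)) (T (EuclideanSpace.single j (1 : ℝ)))
      = (A * LinearMap.toMatrix b b T) i j := by
    intro i j
    rw [hexp, Matrix.mul_apply]
    refine Finset.sum_congr rfl fun k _ => ?_
    rw [LinearMap.toMatrix_apply, hb]
    simp [b]
  rw [LinearMap.trace_eq_matrix_trace ℝ b,
    ← Matrix.nonsing_inv_mul_cancel_left A (LinearMap.toMatrix b b T) hdet]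
  -- `metricTrace` pairs matrices entry by entry, which is the trace of a product with one factor
  -- transposed. Symmetry of `A` makes the transpose harmless.
  have hinv : A⁻¹ = (A⁻¹).transpose := by rw [Matrix.transpose_nonsing_inv, hAt]
  rw [hinv, Matrix.trace]
  simp only [metricTrace, hmul, ← hA, Matrix.diag_apply, Matrix.mul_apply (M := A⁻¹.transpose),
    Matrix.transpose_apply]
  exact Finset.sum_comm

/-- The `*`-scalar trace of a tensor `R` with `2 R + σ g ⊼ g + g ⊼ L = 0`. -/
lemma metricTrace_metricTrace_of_kulkarniNomizu (hsymm : ∀ x y, g x y = g y x)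
    (hg : ∀ x, (∀ y, g x y = 0) → x = 0)
    {R : EuclideanSpace ℝ (Fin d) → EuclideanSpace ℝ (Fin d) → EuclideanSpace ℝ (Fin d) →
      EuclideanSpace ℝ (Fin d) → ℝ} {L : EuclideanSpace ℝ (Fin d) → EuclideanSpace ℝ (Fin d) → ℝ}
    {σ : ℝ} (hR : ∀ x y z w, 2 * R x y z w
      + σ * kulkarniNomizu (fun a b => g a b) (fun a b => g a b) x y z w
      + kulkarniNomizu (fun a b => g a b) L x y z w = 0)
    (Λ J : EuclideanSpace ℝ (Fin d) →ₗ[ℝ] EuclideanSpace ℝ (Fin d))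
    (hL : ∀ a b, L a b = g a (Λ b)) (hJ : LinearMap.trace ℝ _ J = 0) :
    metricTrace g (fun a b => metricTrace g (fun c e => R c a (J b) e))
      = -((d - 2 : ℝ) / 2) * LinearMap.trace ℝ _ (Λ ∘ₗ J) := by
  have hric : ∀ y z, metricTrace g (fun c e => R c y z e) =
      g y ((-((d - 2) / 2 : ℝ)) • Λ z
        + (-(LinearMap.trace ℝ _ Λ / 2 + (d - 1) * σ)) • z) := by
    intro y z
    -- The soliton equation solved for `R`, read as an operator in the outer slots `c` and `e`. Its
    -- last two terms have rank at most one, so their traces are evaluations of `g y`.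
    let T : EuclideanSpace ℝ (Fin d) →ₗ[ℝ] EuclideanSpace ℝ (Fin d) :=
      (-(σ * g y z + L y z / 2)) • LinearMap.id + (-(g y z / 2)) • Λ
        + (g y : EuclideanSpace ℝ (Fin d) →ₗ[ℝ] ℝ).smulRight (σ • z + (1 / 2 : ℝ) • Λ z)
        + (1 / 2 : ℝ) • ((g y : EuclideanSpace ℝ (Fin d) →ₗ[ℝ] ℝ) ∘ₗ Λ).smulRight z
    have h1 : (fun c e => R c y z e) = fun c e => g c (T e) := by
      ext c e
      have := hR c y z e
      simp only [kulkarniNomizu, hL] at this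
      simp [T, hL]
      linarith
    rw [h1, metricTrace_eq_trace hsymm hg]
    simp only [T, map_add, map_smul, LinearMap.trace_id, LinearMap.trace_smulRight, smul_eq_mul, hL]
    simp
    ring
  simp only [hric]
  have := metricTrace_eq_trace hsymm hg ((-((d - 2) / 2 : ℝ)) • Λ ∘ₗ J
        + (-(LinearMap.trace ℝ _ Λ / 2 + (d - 1) * σ)) • J)
  simp only [LinearMap.add_apply, LinearMap.smul_apply, LinearMap.comp_apply] at this
  rw [this]
  simp [hJ]

end MetricTrace

/-! ### Parallel structures in a chart -/

namespace InChart

open Filter Topology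

section

variable {D E F : Type*} [NormedAddCommGroup D] [NormedSpace ℝ D] [NormedAddCommGroup E]
  [NormedSpace ℝ E] [NormedAddCommGroup F] [NormedSpace ℝ F]

/-- In finite dimension an operator is the tuple of its values on a basis. -/
lemma differentiableAt_clm_of_apply [FiniteDimensional ℝ E] {f : D → E →L[ℝ] F} {x : D}
    (h : ∀ a, DifferentiableAt ℝ (fun y => f y a) x) : DifferentiableAt ℝ f x := by
  let e₁ := ContinuousLinearEquiv.ofFinrankEq (𝕜 := ℝ) (E := E)
    (F := Fin (Module.finrank ℝ E) → ℝ) (by simp)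
  let e₂ := (e₁.arrowCongr (1 : F ≃L[ℝ] F)).trans
    (ContinuousLinearEquiv.piRing (𝕜 := ℝ) (E := F) (Fin (Module.finrank ℝ E)))
  rw [← e₂.comp_differentiableAt_iff]
  rw [differentiableAt_pi]
  intro i
  exact h _

lemma differentiableAt_clm_of_apply₂ [FiniteDimensional ℝ E] {f : D → E →L[ℝ] E →L[ℝ] F} {x : D}
    (h : ∀ a b, DifferentiableAt ℝ (fun y => f y a b) x) : DifferentiableAt ℝ f x :=
  differentiableAt_clm_of_apply fun a => differentiableAt_clm_of_apply fun b => h a b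

end

variable {E : Type*} [NormedAddCommGroup E] [NormedSpace ℝ E]

section

variable {G : E → E →L[ℝ] E →L[ℝ] ℝ} {y : E}

lemma christoffel_apply (hinv : (G y).IsInvertible) (a b c : E) :
    G y (christoffel G y a b) c
      = (1 / 2) * (fderiv ℝ G y a b c + fderiv ℝ G y b a c - fderiv ℝ G y c a b) := by
  rw [christoffel, hinv.apply_inverse_apply]
  simp

lemma fderiv_form_apply (hG : DifferentiableAt ℝ G y) {A B : E → E}
    (hA : DifferentiableAt ℝ A y) (hB : DifferentiableAt ℝ B y) (v : E) :
    fderiv ℝ (fun z => G z (A z) (B z)) y v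
      = fderiv ℝ G y v (A y) (B y) + G y (fderiv ℝ A y v) (B y) + G y (A y) (fderiv ℝ B y v) := by
  rw [fderiv_clm_apply (hG.clm_apply hA) hB, fderiv_clm_apply hG hA]
  simp
  ring

lemma fderiv_form_apply_const (hG : DifferentiableAt ℝ G y) (a b v : E) :
    fderiv ℝ (fun z => G z a b) y v = fderiv ℝ G y v a b := by
  simpa using fderiv_form_apply hG (A := fun _ => a) (B := fun _ => b) (by fun_prop) (by fun_prop) v

lemma fderiv_form_symm (hG : DifferentiableAt ℝ G y)
    (hsymm : ∀ᶠ z in 𝓝 y, ∀ a b, G z a b = G z b a) (v a b : E) :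
    fderiv ℝ G y v a b = fderiv ℝ G y v b a := by
  rw [← fderiv_form_apply_const hG, ← fderiv_form_apply_const hG]
  have : (fun z => G z a b) =ᶠ[𝓝 y] fun z => G z b a := hsymm.mono fun z hz => hz a b
  rw [this.fderiv_eq]

lemma christoffel_symm (hG : DifferentiableAt ℝ G y)
    (hsymm : ∀ᶠ z in 𝓝 y, ∀ a b, G z a b = G z b a) (a b : E) :
    christoffel G y a b = christoffel G y b a := by
  simp only [christoffel]
  congr 2
  ext c
  simp [fderiv_form_symm hG hsymm c a b, add_comm]

end

/-- `(G, Φ, X)` are the components, near `y`, of the metric, the endomorphism and the Reeb field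
of an almost contact B-metric structure, with `∇Φ = 0` at `y`. -/
structure IsCosymplecticAt (G : E → E →L[ℝ] E →L[ℝ] ℝ) (Φ : E → E →L[ℝ] E) (X : E → E)
    (y : E) : Prop where
  differentiableAt_form : DifferentiableAt ℝ G y
  differentiableAt_endo : DifferentiableAt ℝ Φ y
  differentiableAt_vector : DifferentiableAt ℝ X y
  isInvertible : (G y).IsInvertible
  symm : ∀ᶠ z in 𝓝 y, ∀ a b, G z a b = G z b a
  form_self : ∀ᶠ z in 𝓝 y, G z (X z) (X z) = 1
  endo_vector : ∀ᶠ z in 𝓝 y, Φ z (X z) = 0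
  endo_endo : ∀ a, Φ y (Φ y a) = -a + G y a (X y) • X y
  covDerivEndo_eq_zero : ∀ a b, covDerivEndo G Φ y a b = 0

namespace IsCosymplecticAt

variable {G : E → E →L[ℝ] E →L[ℝ] ℝ} {Φ : E → E →L[ℝ] E} {X : E → E} {y : E}

/-- The Reeb field is parallel. -/
lemma fderiv_vector (h : IsCosymplecticAt G Φ X y) (a : E) :
    fderiv ℝ X y a = -christoffel G y a (X y) := by
  rw [← add_eq_zero_iff_eq_neg]
  -- `N` is `∇_a X`. Differentiating `Φ X = 0` with `∇Φ = 0` gives `Φ N = 0`, and differentiating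
  -- `G(X, X) = 1` gives `G(N, X) = 0`. Then `Φ² N = -N + G(N, X) X` forces `N = 0`.
  set N := fderiv ℝ X y a + christoffel G y a (X y) with hN
  have h1 : fderiv ℝ Φ y a (X y) + Φ y (fderiv ℝ X y a) = 0 := by
    have : (fun z => Φ z (X z)) =ᶠ[𝓝 y] fun _ => 0 := h.endo_vector
    have h2 := congrArg (fun f : E →L[ℝ] E => f a) this.fderiv_eq
    rw [fderiv_clm_apply h.differentiableAt_endo h.differentiableAt_vector] at h2
    simpa [add_comm] using h2
  have h2 : Φ y N = 0 := by
    have h3 := h.covDerivEndo_eq_zero a (X y)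
    have h4 : christoffel G y a 0 = 0 := by simp [christoffel]
    rw [covDerivEndo, h.endo_vector.self_of_nhds, h4, add_zero] at h3
    rw [hN, map_add, ← sub_eq_zero.mp h3, add_comm, h1]
  have h3 : G y N (X y) = 0 := by
    have : (fun z => G z (X z) (X z)) =ᶠ[𝓝 y] fun _ => 1 := h.form_self
    have h4 := congrArg (fun f : E →L[ℝ] ℝ => f a) this.fderiv_eq
    simp only [fderiv_form_apply h.differentiableAt_form h.differentiableAt_vector
      h.differentiableAt_vector] at h4
    rw [h.symm.self_of_nhds (X y)] at h4
    rw [hN, map_add, add_apply, christoffel_apply h.isInvertible]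
    rw [fderiv_form_symm h.differentiableAt_form h.symm (X y) a]
    simp at h4
    linarith
  have h4 := h.endo_endo N
  rw [h2, h3] at h4
  simpa using h4.symm

/-- The Reeb field is a Killing field. -/
lemma lieDerivForm_eq_zero (h : IsCosymplecticAt G Φ X y) (a b : E) :
    fderiv ℝ G y (X y) a b + G y (fderiv ℝ X y a) b + G y a (fderiv ℝ X y b) = 0 := by
  have hs := fderiv_form_symm h.differentiableAt_form h.symm
  rw [h.symm.self_of_nhds a, h.fderiv_vector, h.fderiv_vector]
  simp only [map_neg, neg_apply, christoffel_apply h.isInvertible]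
  rw [hs (X y) b a, hs a (X y) b, hs b (X y) a]
  ring

/-- The Reeb field preserves the endomorphism. -/
lemma lieDerivEndo_eq_zero (h : IsCosymplecticAt G Φ X y) (b : E) :
    fderiv ℝ Φ y (X y) b + Φ y (fderiv ℝ X y b) - fderiv ℝ X y (Φ y b) = 0 := by
  -- As `X` is parallel and the connection has no torsion, the Lie derivative of `Φ` along `X` is
  -- `∇_X Φ`.
  have h1 := h.covDerivEndo_eq_zero (X y) b
  rw [covDerivEndo] at h1
  rw [h.fderiv_vector, h.fderiv_vector, christoffel_symm h.differentiableAt_form h.symm b,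
    christoffel_symm h.differentiableAt_form h.symm (Φ y b), map_neg, sub_neg_eq_add, ← h1]
  abel

/-- The Lie derivative of a form built from the structure, along a multiple of the Reeb field. -/
lemma lieDerivForm_smul [FiniteDimensional ℝ E] (h : IsCosymplecticAt G Φ X y) {α β γ f : E → ℝ}
    (hα : DifferentiableAt ℝ α y) (hβ : DifferentiableAt ℝ β y) (hγ : DifferentiableAt ℝ γ y)
    (hf : DifferentiableAt ℝ f y) {B : E → E →L[ℝ] E →L[ℝ] ℝ}
    (hB : ∀ᶠ z in 𝓝 y, ∀ a b, B z a b
      = α z * G z a b + β z * G z a (Φ z b) + γ z * (G z a (X z) * G z b (X z)))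
    {Y : E → E} (hY : ∀ᶠ z in 𝓝 y, Y z = f z • X z) (a b : E) :
    lieDerivForm B Y y a b
      = f y * (fderiv ℝ α y (X y) * G y a b + fderiv ℝ β y (X y) * G y a (Φ y b)
          + fderiv ℝ γ y (X y) * (G y a (X y) * G y b (X y)))
        + fderiv ℝ f y a * B y (X y) b + fderiv ℝ f y b * B y a (X y) := by
  have hG := h.differentiableAt_form
  have hΦ := h.differentiableAt_endo
  have hX := h.differentiableAt_vector
  have hc : ∀ c : E, DifferentiableAt ℝ (fun _ : E => c) y := fun c => by fun_prop
  have hΦc : ∀ c : E, DifferentiableAt ℝ (fun z => Φ z c) y := fun c => by fun_prop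
  have hBab : ∀ a b, (fun z => B z a b) =ᶠ[𝓝 y] fun z =>
      α z * G z a b + β z * G z a (Φ z b) + γ z * (G z a (X z) * G z b (X z)) :=
    fun a b => hB.mono fun z hz => hz a b
  have hd1 : ∀ a b, DifferentiableAt ℝ (fun z => G z a b) y := fun a b => by fun_prop
  have hd2 : ∀ a b, DifferentiableAt ℝ (fun z => G z a (Φ z b)) y := fun a b => by fun_prop
  have hd3 : ∀ a, DifferentiableAt ℝ (fun z => G z a (X z)) y := fun a => by fun_prop
  -- Differentiability of `B` comes from its expression in the structure tensors.
  have hBd : DifferentiableAt ℝ B y :=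
    differentiableAt_clm_of_apply₂ fun a b => by
      refine DifferentiableAt.congr_of_eventuallyEq ?_ (hBab a b)
      have := hd1 a b
      have := hd2 a b
      have := hd3 a
      have := hd3 b
      fun_prop
  have hBfd : fderiv ℝ B y (X y) a b =
      fderiv ℝ α y (X y) * G y a b + α y * fderiv ℝ G y (X y) a b
      + (fderiv ℝ β y (X y) * G y a (Φ y b)
        + β y * (fderiv ℝ G y (X y) a (Φ y b) + G y a (fderiv ℝ Φ y (X y) b)))
      + (fderiv ℝ γ y (X y) * (G y a (X y) * G y b (X y))
        + γ y * ((fderiv ℝ G y (X y) a (X y) + G y a (fderiv ℝ X y (X y))) * G y b (X y)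
          + G y a (X y) * (fderiv ℝ G y (X y) b (X y) + G y b (fderiv ℝ X y (X y))))) := by
    rw [← fderiv_form_apply_const hBd, (hBab a b).fderiv_eq]
    have hΦ' : fderiv ℝ (fun z => Φ z b) y (X y) = fderiv ℝ Φ y (X y) b := by
      rw [fderiv_clm_apply hΦ (hc b)]; simp
    have e2 := fderiv_form_apply hG (hc a) (hΦc b) (X y)
    have e3 := fun a => fderiv_form_apply hG (hc a) hX (X y)
    rw [fderiv_fun_add ((hα.fun_mul (hd1 a b)).fun_add (hβ.fun_mul (hd2 a b)))
      (hγ.fun_mul ((hd3 a).fun_mul (hd3 b))), fderiv_fun_add (hα.fun_mul (hd1 a b)) (hβ.fun_mul (hd2 a b)),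
      fderiv_fun_mul hα (hd1 a b), fderiv_fun_mul hβ (hd2 a b),
      fderiv_fun_mul hγ ((hd3 a).fun_mul (hd3 b)), fderiv_fun_mul (hd3 a) (hd3 b)]
    simp only [add_apply, smul_apply, smul_eq_mul, e2, e3, fderiv_form_apply_const hG, hΦ']
    simp
    ring
  have hYe : Y =ᶠ[𝓝 y] fun z => f z • X z := hY
  have hYfd : ∀ c, fderiv ℝ Y y c = f y • fderiv ℝ X y c + fderiv ℝ f y c • X y := by
    intro c
    rw [hYe.fderiv_eq, fderiv_fun_smul hf hX]
    simp
  have l1 := h.lieDerivForm_eq_zero a b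
  have l2 := h.lieDerivForm_eq_zero a (Φ y b)
  have l3 := h.lieDerivForm_eq_zero a (X y)
  have l4 := h.lieDerivForm_eq_zero b (X y)
  have l5 := congrArg (G y a) (h.lieDerivEndo_eq_zero b)
  simp only [map_add, map_sub, map_zero] at l5
  rw [lieDerivForm, hYfd, hYfd, hY.self_of_nhds]
  simp only [map_add, map_smul, add_apply, smul_apply, smul_eq_mul, hBfd]
  rw [hB.self_of_nhds (fderiv ℝ X y a) b, hB.self_of_nhds a (fderiv ℝ X y b)]
  -- Where no coefficient is differentiated, each summand vanishes: `l1` handles `G`, `l2` with `l5`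
  -- handles `G(·, Φ ·)`, and `l3`, `l4` handle the square of `G(·, X)`.
  linear_combination f y * α y * l1 + f y * β y * l2 + f y * β y * l5
    + f y * γ y * G y b (X y) * l3 + f y * γ y * G y a (X y) * l4

end IsCosymplecticAt

end InChart

/-! ### Tensor fields in the preferred chart -/

namespace TensorField

open Filter Topology

variable {d : ℕ} {M : Type*} [TopologicalSpace M] [ChartedSpace (EuclideanSpace ℝ (Fin d)) M]

section Functions

variable {F : Type*} [NormedAddCommGroup F] [NormedSpace ℝ F]

lemma extChartAt_target_eventually (p : M) :
    ∀ᶠ y in 𝓝 (extChartAt (𝓡 d) p p), y ∈ (extChartAt (𝓡 d) p).target :=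
  extChartAt_target_mem_nhds (I := 𝓡 d) p

lemma differential_eq_fderiv {f : M → ℝ} {p : M} (hf : MDifferentiableAt (𝓡 d) 𝓘(ℝ, ℝ) f p)
    (x : TangentSpace (𝓡 d) p) :
    differential f p x
      = fderiv ℝ (fun y => f ((extChartAt (𝓡 d) p).symm y)) (extChartAt (𝓡 d) p p) x := by
  rw [differential, hf.mfderiv, ModelWithCorners.range_eq_univ, fderivWithin_univ]
  rfl

variable [IsManifold (𝓡 d) ∞ M]

lemma differentiableAt_comp_extChartAt_symm {f : M → F} {p : M}
    (hf : ContMDiffAt (𝓡 d) 𝓘(ℝ, F) ∞ f p) :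
    DifferentiableAt ℝ (fun y => f ((extChartAt (𝓡 d) p).symm y)) (extChartAt (𝓡 d) p p) := by
  have h1 : ContMDiffAt 𝓘(ℝ, EuclideanSpace ℝ (Fin d)) (𝓡 d) ∞ (extChartAt (𝓡 d) p).symm
      (extChartAt (𝓡 d) p p) :=
    (contMDiffOn_extChartAt_symm p).contMDiffAt (extChartAt_target_mem_nhds (I := 𝓡 d) p)
  have h2 : ContMDiffAt 𝓘(ℝ, EuclideanSpace ℝ (Fin d)) 𝓘(ℝ, F) ∞
      (f ∘ (extChartAt (𝓡 d) p).symm) (extChartAt (𝓡 d) p p) :=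
    ContMDiffAt.comp _ (by rwa [extChartAt_to_inv]) h1
  exact (contMDiffAt_iff_contDiffAt.mp h2).differentiableAt (by simp)

end Functions

section Frames

variable [IsManifold (𝓡 d) ∞ M]

omit [IsManifold (𝓡 d) ∞ M] in
lemma chartFrame_eq_mfderivWithin (p : M) (y : EuclideanSpace ℝ (Fin d)) :
    chartFrame M p y = mfderivWithin 𝓘(ℝ, EuclideanSpace ℝ (Fin d)) (𝓡 d)
      (extChartAt (𝓡 d) p).symm (Set.range (𝓡 d)) y := by
  rw [chartFrame, ModelWithCorners.range_eq_univ, mfderivWithin_univ]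

lemma chartFrame_chartCoframe {p : M} {y : EuclideanSpace ℝ (Fin d)}
    (hy : y ∈ (extChartAt (𝓡 d) p).target) (a : EuclideanSpace ℝ (Fin d)) :
    chartFrame M p y (chartCoframe M p y a) = a := by
  have : IsManifold (𝓡 d) 1 M := IsManifold.of_le (n := ∞) (by simp)
  have h := mfderivWithin_extChartAt_symm_comp_mfderiv_extChartAt (I := 𝓡 d) hy
  rw [chartFrame_eq_mfderivWithin]
  exact congrArg (fun f : EuclideanSpace ℝ (Fin d) →L[ℝ] EuclideanSpace ℝ (Fin d) => f a) h

lemma chartCoframe_self (p : M) (a : EuclideanSpace ℝ (Fin d)) :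
    chartCoframe M p (extChartAt (𝓡 d) p p) a = a := by
  have : IsManifold (𝓡 d) 1 M := IsManifold.of_le (n := ∞) (by simp)
  have h := mfderiv_extChartAt_self (I := 𝓡 d) (x := p)
  -- The base point equals `p` only propositionally and the derivative depends on it, so the point
  -- is generalized before substitution.
  have h2 : ∀ q, q = p → (mfderiv (𝓡 d) 𝓘(ℝ, EuclideanSpace ℝ (Fin d)) (extChartAt (𝓡 d) p) q :
      EuclideanSpace ℝ (Fin d) →L[ℝ] EuclideanSpace ℝ (Fin d)) a = a := by
    rintro q rfl
    exact congrArg (fun f : EuclideanSpace ℝ (Fin d) →L[ℝ] EuclideanSpace ℝ (Fin d) => f a) h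
  exact h2 _ (extChartAt_to_inv p)

lemma chartFrame_self (p : M) (a : EuclideanSpace ℝ (Fin d)) :
    chartFrame M p (extChartAt (𝓡 d) p p) a = a := by
  have := chartFrame_chartCoframe (mem_extChartAt_target (I := 𝓡 d) p) a
  rwa [chartCoframe_self] at this

omit [IsManifold (𝓡 d) ∞ M] in
lemma formInChart_apply
    (g : ∀ q : M, TangentSpace (𝓡 d) q →L[ℝ] TangentSpace (𝓡 d) q →L[ℝ] ℝ) (p : M)
    (y a b : EuclideanSpace ℝ (Fin d)) :
    formInChart g p y a b
      = g ((extChartAt (𝓡 d) p).symm y) (chartFrame M p y a) (chartFrame M p y b) := rfl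

omit [IsManifold (𝓡 d) ∞ M] in
lemma endoInChart_apply (φ : ∀ q : M, TangentSpace (𝓡 d) q →L[ℝ] TangentSpace (𝓡 d) q) (p : M)
    (y a : EuclideanSpace ℝ (Fin d)) :
    endoInChart φ p y a
      = chartCoframe M p y (φ ((extChartAt (𝓡 d) p).symm y) (chartFrame M p y a)) := rfl

lemma chartFrame_endoInChart (φ : ∀ q : M, TangentSpace (𝓡 d) q →L[ℝ] TangentSpace (𝓡 d) q)
    {p : M} {y : EuclideanSpace ℝ (Fin d)} (hy : y ∈ (extChartAt (𝓡 d) p).target)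
    (a : EuclideanSpace ℝ (Fin d)) :
    chartFrame M p y (endoInChart φ p y a)
      = φ ((extChartAt (𝓡 d) p).symm y) (chartFrame M p y a) :=
  chartFrame_chartCoframe hy _

lemma chartFrame_vectorInChart (X : ∀ q : M, TangentSpace (𝓡 d) q)
    {p : M} {y : EuclideanSpace ℝ (Fin d)} (hy : y ∈ (extChartAt (𝓡 d) p).target) :
    chartFrame M p y (vectorInChart X p y) = X ((extChartAt (𝓡 d) p).symm y) :=
  chartFrame_chartCoframe hy _

lemma formInChart_self
    (g : ∀ q : M, TangentSpace (𝓡 d) q →L[ℝ] TangentSpace (𝓡 d) q →L[ℝ] ℝ) (p : M) :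
    formInChart g p (extChartAt (𝓡 d) p p) = g p := by
  ext a b
  rw [formInChart_apply, chartFrame_self, chartFrame_self]
  exact congrArg (fun q : M => (g q : EuclideanSpace ℝ (Fin d) →L[ℝ] EuclideanSpace ℝ (Fin d)
    →L[ℝ] ℝ) a b) (extChartAt_to_inv p)

lemma endoInChart_self (φ : ∀ q : M, TangentSpace (𝓡 d) q →L[ℝ] TangentSpace (𝓡 d) q) (p : M) :
    endoInChart φ p (extChartAt (𝓡 d) p p) = φ p := by
  ext1 a
  refine (chartCoframe_self p _).trans ?_
  change φ _ (chartFrame M p (extChartAt (𝓡 d) p p) a) = _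
  refine (congrArg (φ ((extChartAt (𝓡 d) p).symm (extChartAt (𝓡 d) p p)))
    (chartFrame_self p a)).trans ?_
  exact congrArg (fun q : M => (φ q : EuclideanSpace ℝ (Fin d) →L[ℝ] EuclideanSpace ℝ (Fin d)) a)
    (extChartAt_to_inv p)

lemma vectorInChart_self (X : ∀ q : M, TangentSpace (𝓡 d) q) (p : M) :
    vectorInChart X p (extChartAt (𝓡 d) p p) = X p := by
  refine (chartCoframe_self p _).trans ?_
  exact congrArg (fun q : M => (X q : EuclideanSpace ℝ (Fin d))) (extChartAt_to_inv p)

end Frames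

/-! ### Differentiability of the components of smooth tensor fields -/

section Smoothness

variable [IsManifold (𝓡 d) ∞ M]

/-- The derivative of the chart is the trivialization of the tangent bundle in which smoothness of
sections is tested. -/
lemma differentiableAt_vectorInChart {X : ∀ q : M, TangentSpace (𝓡 d) q} {p : M}
    (hX : ContMDiffAt (𝓡 d) ((𝓡 d).prod 𝓘(ℝ, EuclideanSpace ℝ (Fin d))) ∞
      (fun q => Bundle.TotalSpace.mk' (EuclideanSpace ℝ (Fin d))
        (E := fun q : M => TangentSpace (𝓡 d) q) q (X q)) p) :
    DifferentiableAt ℝ (vectorInChart X p) (extChartAt (𝓡 d) p p) := by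
  have : IsManifold (𝓡 d) 1 M := IsManifold.of_le (n := ∞) (by simp)
  rw [Bundle.contMDiffAt_section] at hX
  refine (differentiableAt_comp_extChartAt_symm hX).congr_of_eventuallyEq ?_
  filter_upwards [extChartAt_target_eventually p] with y hy
  have hq : (extChartAt (𝓡 d) p).symm y ∈ (chartAt (EuclideanSpace ℝ (Fin d)) p).source := by
    rw [← extChartAt_source (𝓡 d)]
    exact (extChartAt (𝓡 d) p).map_target hy
  have h1 := TangentBundle.continuousLinearMapAt_trivializationAt (I := 𝓡 d) hq
  rw [vectorInChart, chartCoframe, ← h1]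
  exact congrFun (Bundle.Trivialization.coe_linearMapAt_of_mem (R := ℝ)
    (trivializationAt (EuclideanSpace ℝ (Fin d)) (TangentSpace (𝓡 d)) p) (by simpa using hq))
    (X ((extChartAt (𝓡 d) p).symm y))

/-- The coordinate vector field with components `a` in the preferred chart at `p`. -/
noncomputable def coordinateField (p : M) (a : EuclideanSpace ℝ (Fin d)) (q : M) : TangentSpace (𝓡 d) q :=
  (trivializationAt (EuclideanSpace ℝ (Fin d)) (TangentSpace (𝓡 d)) p).symmL ℝ q a

/-- The field is constant in the trivialization. Evaluating tensor fields on such fields reduces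
their components to functions and vector fields. -/
lemma contMDiffAt_coordinateField (p : M) (a : EuclideanSpace ℝ (Fin d)) :
    ContMDiffAt (𝓡 d) ((𝓡 d).prod 𝓘(ℝ, EuclideanSpace ℝ (Fin d))) ∞
      (fun q => Bundle.TotalSpace.mk' (EuclideanSpace ℝ (Fin d))
        (E := fun q : M => TangentSpace (𝓡 d) q) q (coordinateField p a q)) p := by
  rw [Bundle.contMDiffAt_section]
  refine (contMDiffAt_const (c := a)).congr_of_eventuallyEq ?_
  filter_upwards [(trivializationAt (EuclideanSpace ℝ (Fin d)) (TangentSpace (𝓡 d))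
    p).open_baseSet.mem_nhds (FiberBundle.mem_baseSet_trivializationAt' p)] with q hq
  rw [coordinateField, Bundle.Trivialization.symmL_apply _ hq,
    Bundle.Trivialization.apply_mk_symm _ hq]

lemma coordinateField_extChartAt_symm {p : M} {y : EuclideanSpace ℝ (Fin d)}
    (hy : y ∈ (extChartAt (𝓡 d) p).target) (a : EuclideanSpace ℝ (Fin d)) :
    coordinateField p a ((extChartAt (𝓡 d) p).symm y) = chartFrame M p y a := by
  have : IsManifold (𝓡 d) 1 M := IsManifold.of_le (n := ∞) (by simp)
  have hq : (extChartAt (𝓡 d) p).symm y ∈ (chartAt (EuclideanSpace ℝ (Fin d)) p).source := by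
    rw [← extChartAt_source (𝓡 d)]
    exact (extChartAt (𝓡 d) p).map_target hy
  rw [coordinateField, TangentBundle.symmL_trivializationAt (I := 𝓡 d) hq,
    chartFrame_eq_mfderivWithin, (extChartAt (𝓡 d) p).right_inv hy]
  rfl

lemma differentiableAt_endoInChart {φ : ∀ q : M, TangentSpace (𝓡 d) q →L[ℝ] TangentSpace (𝓡 d) q}
    {p : M}
    (hφ : ContMDiffAt (𝓡 d)
      ((𝓡 d).prod 𝓘(ℝ, EuclideanSpace ℝ (Fin d) →L[ℝ] EuclideanSpace ℝ (Fin d))) ∞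
      (fun q => Bundle.TotalSpace.mk' (EuclideanSpace ℝ (Fin d) →L[ℝ] EuclideanSpace ℝ (Fin d))
        (E := fun q : M => TangentSpace (𝓡 d) q →L[ℝ] TangentSpace (𝓡 d) q) q (φ q)) p) :
    DifferentiableAt ℝ (endoInChart φ p) (extChartAt (𝓡 d) p p) := by
  refine InChart.differentiableAt_clm_of_apply fun a => ?_
  have h := differentiableAt_vectorInChart (hφ.clm_bundle_apply (contMDiffAt_coordinateField p a))
  refine h.congr_of_eventuallyEq ?_
  filter_upwards [extChartAt_target_eventually p] with y hy
  rw [endoInChart_apply, vectorInChart, coordinateField_extChartAt_symm hy]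

lemma differentiableAt_formInChart
    {g : ∀ q : M, TangentSpace (𝓡 d) q →L[ℝ] TangentSpace (𝓡 d) q →L[ℝ] ℝ} {p : M}
    (hg : ContMDiffAt (𝓡 d) ((𝓡 d).prod 𝓘(ℝ, EuclideanSpace ℝ (Fin d) →L[ℝ]
        EuclideanSpace ℝ (Fin d) →L[ℝ] ℝ)) ∞
      (fun q => Bundle.TotalSpace.mk' (EuclideanSpace ℝ (Fin d) →L[ℝ]
          EuclideanSpace ℝ (Fin d) →L[ℝ] ℝ)
        (E := fun q : M => TangentSpace (𝓡 d) q →L[ℝ] TangentSpace (𝓡 d) q →L[ℝ]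
          Bundle.Trivial M ℝ q) q (g q)) p) :
    DifferentiableAt ℝ (formInChart g p) (extChartAt (𝓡 d) p p) := by
  refine InChart.differentiableAt_clm_of_apply₂ fun a b => ?_
  have h := hg.clm_bundle_apply₂ (contMDiffAt_coordinateField p a) (contMDiffAt_coordinateField p b)
  rw [Bundle.contMDiffAt_section] at h
  refine (differentiableAt_comp_extChartAt_symm h).congr_of_eventuallyEq ?_
  filter_upwards [extChartAt_target_eventually p] with y hy
  rw [formInChart_apply, ← coordinateField_extChartAt_symm hy, ← coordinateField_extChartAt_symm hy]
  rfl

end Smoothness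

end TensorField

/-! ### Almost contact B-metric structures on a vector space -/

/-- An almost contact B-metric structure on a vector space. -/
structure IsAccRSpace {E : Type*} [NormedAddCommGroup E] [NormedSpace ℝ E] (φ : E →L[ℝ] E) (ξ : E)
    (η : E →L[ℝ] ℝ) (g : E →L[ℝ] E →L[ℝ] ℝ) : Prop where
  φ_ξ : φ ξ = 0
  φ_φ : ∀ x, φ (φ x) = -x + η x • ξ
  η_φ : ∀ x, η (φ x) = 0
  η_ξ : η ξ = 1
  g_φ_φ : ∀ x y, g (φ x) (φ y) = -g x y + η x * η y
  symm : ∀ x y, g x y = g y x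
  nondegenerate : ∀ x, (∀ y, g x y = 0) → x = 0

namespace IsAccRSpace

section

variable {E : Type*} [NormedAddCommGroup E] [NormedSpace ℝ E] {φ : E →L[ℝ] E} {ξ : E}
  {η : E →L[ℝ] ℝ} {g : E →L[ℝ] E →L[ℝ] ℝ}

/-- Put `y = ξ` in the compatibility of `g` and `φ`, where the left side vanishes. -/
lemma g_ξ (h : IsAccRSpace φ ξ η g) (x : E) : g x ξ = η x := by
  have := h.g_φ_φ x ξ
  rw [h.φ_ξ, map_zero, h.η_ξ] at this
  linarith

lemma g_φ (h : IsAccRSpace φ ξ η g) (x y : E) : g (φ x) y = g x (φ y) := by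
  have := h.g_φ_φ x (φ y)
  rw [h.φ_φ, h.η_φ, map_add, map_neg, map_smul, h.g_ξ, h.η_φ] at this
  simp at this
  linarith

lemma trace_φ [FiniteDimensional ℝ E] (h : IsAccRSpace φ ξ η g) :
    LinearMap.trace ℝ E (φ : E →ₗ[ℝ] E) = 0 := by
  refine LinearMap.trace_eq_zero_of_cube_eq_neg _ ?_
  ext x
  simp [pow_succ, h.φ_φ, h.φ_ξ]

/-- `φ²` is `-id` plus the projection `η ⊗ ξ`, whose trace is `η ξ = 1`. -/
lemma trace_φ_φ [FiniteDimensional ℝ E] (h : IsAccRSpace φ ξ η g) :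
    LinearMap.trace ℝ E ((φ : E →ₗ[ℝ] E) ∘ₗ φ) = 1 - Module.finrank ℝ E := by
  have : (φ : E →ₗ[ℝ] E) ∘ₗ φ = -LinearMap.id + (η : E →ₗ[ℝ] ℝ).smulRight ξ := by
    ext x
    simp [h.φ_φ]
  rw [this, map_add, map_neg, LinearMap.trace_id, LinearMap.trace_smulRight]
  simp [h.η_ξ]
  ring

variable {α β ε : ℝ} {g' : E →L[ℝ] E →L[ℝ] ℝ}

lemma contactConformal_symm (h : IsAccRSpace φ ξ η g)
    (hg' : ∀ x y, g' x y = α * g x y + β * g x (φ y) + (ε - α) * (η x * η y)) (x y : E) :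
    g' x y = g' y x := by
  rw [hg', hg', h.symm x y, ← h.g_φ x y, h.symm (φ x) y]
  ring

lemma contactConformal_ξ (h : IsAccRSpace φ ξ η g)
    (hg' : ∀ x y, g' x y = α * g x y + β * g x (φ y) + (ε - α) * (η x * η y)) (x : E) :
    g' x ξ = ε * η x := by
  rw [hg', h.φ_ξ, map_zero, h.g_ξ, h.η_ξ]
  ring

/-- Pairing with `ξ` kills `η x`. On `ker η` the form is `g` composed with `α + β φ`, and there `(α
- β φ)(α + β φ) = α² + β²`. -/
lemma contactConformal_nondegenerate (h : IsAccRSpace φ ξ η g)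
    (hg' : ∀ x y, g' x y = α * g x y + β * g x (φ y) + (ε - α) * (η x * η y))
    (hαβ : α ^ 2 + β ^ 2 ≠ 0) (hε : ε ≠ 0) (x : E) (hx : ∀ y, g' x y = 0) : x = 0 := by
  have h1 : η x = 0 := by
    have := hx ξ
    rw [h.contactConformal_ξ hg'] at this
    exact (mul_eq_zero.mp this).resolve_left hε
  have h2 : α • x + β • φ x = 0 := by
    refine h.nondegenerate _ fun y => ?_
    have := hx y
    rw [hg', h1, ← h.g_φ] at this
    simpa using this
  have h3 := congrArg φ h2
  rw [map_add, map_smul, map_smul, h.φ_φ, h1, map_zero, zero_smul, add_zero] at h3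
  have h4 : (α ^ 2 + β ^ 2) • x = 0 := by
    have : (α ^ 2 + β ^ 2) • x = α • (α • x + β • φ x) - β • (α • φ x + β • -x) := by module
    rw [this, h2, h3, smul_zero, smul_zero, sub_zero]
  exact (smul_eq_zero.mp h4).resolve_left hαβ

end

variable {n : ℕ} {φ : EuclideanSpace ℝ (Fin (2 * n + 1)) →L[ℝ] EuclideanSpace ℝ (Fin (2 * n + 1))}
  {ξ : EuclideanSpace ℝ (Fin (2 * n + 1))} {η : EuclideanSpace ℝ (Fin (2 * n + 1)) →L[ℝ] ℝ}
  {g g' B : EuclideanSpace ℝ (Fin (2 * n + 1)) →L[ℝ] EuclideanSpace ℝ (Fin (2 * n + 1)) →L[ℝ] ℝ}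
  {α β ε : ℝ}

/-- The `*`-scalar curvature of the contact conformal metric `g'`, when the curvature is given by
`2 R + σ g' ⊼ g' + g' ⊼ B = 0`, where `B` is the Lie derivative of `g'`. -/
lemma metricTrace_metricTrace_contactConformal (h : IsAccRSpace φ ξ η g)
    (hg' : ∀ x y, g' x y = α * g x y + β * g x (φ y) + (ε - α) * (η x * η y))
    (hαβ : α ^ 2 + β ^ 2 ≠ 0) (hε : ε ≠ 0) {f u v c : ℝ}
    {μ : EuclideanSpace ℝ (Fin (2 * n + 1)) →L[ℝ] ℝ}
    (hB : ∀ a b, B a b = f * (2 * (u * α - v * β) * g a b + 2 * (u * β + v * α) * g a (φ b)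
      + c * (η a * η b)) + μ a * g' ξ b + μ b * g' a ξ)
    {R : EuclideanSpace ℝ (Fin (2 * n + 1)) → EuclideanSpace ℝ (Fin (2 * n + 1)) →
      EuclideanSpace ℝ (Fin (2 * n + 1)) → EuclideanSpace ℝ (Fin (2 * n + 1)) → ℝ} {σ : ℝ}
    (hR : ∀ x y z w, 2 * R x y z w
      + σ * kulkarniNomizu (fun a b => g' a b) (fun a b => g' a b) x y z w
      + kulkarniNomizu (fun a b => g' a b) (fun a b => B a b) x y z w = 0) :
    metricTrace g' (fun a b => metricTrace g' (fun c e => R c a (φ b) e))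
      = 2 * n * (2 * n - 1) * (f * v) := by
  have hsymm := h.contactConformal_symm hg'
  have hnd := h.contactConformal_nondegenerate hg' hαβ hε
  obtain ⟨Λ, hΛ⟩ := exists_operator_of_nondegenerate hsymm hnd B
  let J : EuclideanSpace ℝ (Fin (2 * n + 1)) →ₗ[ℝ] EuclideanSpace ℝ (Fin (2 * n + 1)) := φ
  -- The coefficients in `B` are the parts of `2(u + iv)(α + iβ)`, hence `2f(u + v φ)` on the image
  -- of `φ`. Since `η ∘ φ = 0`, the terms in `c` and in `μ a` disappear. The remaining term has
  -- trace `μ(φ ξ) = 0`.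
  have hcomp : Λ ∘ₗ J = (2 * f * u) • J + (2 * f * v) • (J ∘ₗ J)
      + ((μ : EuclideanSpace ℝ (Fin (2 * n + 1)) →ₗ[ℝ] ℝ) ∘ₗ J).smulRight ξ := by
    refine LinearMap.ext fun b => eq_of_forall_form_eq hsymm hnd fun a => ?_
    have h1 : g' a (Λ (φ b)) = B a (φ b) := (hΛ a (φ b)).symm
    have h2 : φ (φ (φ b)) = -φ b := by
      rw [h.φ_φ (φ b), h.η_φ, zero_smul, add_zero]
    have h3 : g' ξ (φ b) = 0 := by
      rw [hsymm, h.contactConformal_ξ hg', h.η_φ, mul_zero]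
    have h4 := hg' a (φ b)
    have h5 := hg' a (φ (φ b))
    rw [h2, h.η_φ, map_neg] at h5
    rw [h.η_φ] at h4
    simp only [J, LinearMap.comp_apply, LinearMap.add_apply, LinearMap.smul_apply,
      LinearMap.smulRight_apply, ContinuousLinearMap.coe_coe, map_add, map_smul, smul_eq_mul]
    rw [h1, hB, h3, h.η_φ, h4, h5]
    ring
  refine (metricTrace_metricTrace_of_kulkarniNomizu hsymm hnd hR Λ J hΛ h.trace_φ).trans ?_
  rw [hcomp]
  -- The constant is `-(2n - 1)/2 · 2 · (1 - (2n + 1)) = 2n(2n - 1)`.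
  simp only [J, map_add, map_smul, h.trace_φ, h.trace_φ_φ, LinearMap.trace_smulRight]
  simp [h.φ_ξ]
  ring

end IsAccRSpace

/-- Bundles the Lie derivative as a continuous bilinear form, so that a representing operator `Λ`
exists. -/
lemma InChart.exists_form_eq_lieDerivForm {E : Type*} [NormedAddCommGroup E] [NormedSpace ℝ E]
    (G : E → E →L[ℝ] E →L[ℝ] ℝ) (X : E → E) (y : E) :
    ∃ B : E →L[ℝ] E →L[ℝ] ℝ, ∀ a b, lieDerivForm G X y a b = B a b :=
  ⟨fderiv ℝ G y (X y) + (G y ∘L fderiv ℝ X y) + ((G y).flip ∘L fderiv ℝ X y).flip,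
    fun a b => by simp [lieDerivForm]⟩

/-! ### Cosymplectic manifolds and their contact conformal transformations -/

namespace AccRTensors

open Filter Topology TensorField

variable {n : ℕ} {M : Type*} [TopologicalSpace M]
  [ChartedSpace (EuclideanSpace ℝ (Fin (2 * n + 1))) M] [IsManifold (𝓡 (2 * n + 1)) ∞ M]
  {S : AccRTensors n M}

lemma IsAccR.isAccRSpace (hS : S.IsAccR) (p : M) :
    IsAccRSpace (E := EuclideanSpace ℝ (Fin (2 * n + 1))) (S.φ p) (S.ξ p) (S.η p) (S.g p) where
  φ_ξ := hS.φ_ξ p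
  φ_φ := hS.φ_φ p
  η_φ := hS.η_φ p
  η_ξ := hS.η_ξ p
  g_φ_φ := hS.g_φ_φ p
  symm := hS.symm_g p
  nondegenerate := nondegenerate_of_sigPos_add_sigNeg
    (E := EuclideanSpace ℝ (Fin (2 * n + 1))) (S.g p) (hS.symm_g p) (by
      have h1 := hS.sigPos_g p
      have h2 := hS.sigNeg_g p
      rw [finrank_euclideanSpace_fin]
      refine (congrArg₂ (· + ·) h1 h2).trans ?_
      omega)

/-- In the chart `η` is replaced by its equal `G(·, X)`. Nondegeneracy turns `F = 0` into `∇φ = 0`.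
-/
lemma IsF0.isCosymplecticAt (hS : S.IsF0) (p : M) :
    InChart.IsCosymplecticAt (formInChart S.g p) (endoInChart S.φ p) (vectorInChart S.ξ p)
      (extChartAt (𝓡 (2 * n + 1)) p p) where
  differentiableAt_form := differentiableAt_formInChart (hS.smooth_g p)
  differentiableAt_endo := differentiableAt_endoInChart (hS.smooth_φ p)
  differentiableAt_vector := differentiableAt_vectorInChart (hS.smooth_ξ p)
  isInvertible := by
    rw [formInChart_self]
    exact isInvertible_of_nondegenerate _ (hS.isAccRSpace p).nondegenerate
  symm := Eventually.of_forall fun y a b => hS.symm_g _ _ _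
  form_self := by
    filter_upwards [extChartAt_target_eventually p] with y hy
    rw [formInChart_apply, chartFrame_vectorInChart S.ξ hy]
    exact ((hS.isAccRSpace _).g_ξ _).trans (hS.η_ξ _)
  endo_vector := by
    filter_upwards [extChartAt_target_eventually p] with y hy
    rw [endoInChart_apply, chartFrame_vectorInChart S.ξ hy]
    exact (congrArg _ (hS.φ_ξ _)).trans (map_zero _)
  endo_endo a := by
    rw [endoInChart_self, formInChart_self, vectorInChart_self]
    have := (hS.isAccRSpace p).φ_φ a
    rwa [← (hS.isAccRSpace p).g_ξ] at this
  covDerivEndo_eq_zero a b := by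
    refine (hS.isAccRSpace p).nondegenerate _ fun c => hS.F_eq_zero p a b c

-- The `η ⊗ η` inside the associated metric cancels the sine term, leaving the pattern `ε - α` with
-- `ε = e^{2w}`.
omit [IsManifold (𝓡 (2 * n + 1)) ∞ M] in
lemma gTransform_g_apply (S : AccRTensors n M) (u v w : M → ℝ) (p : M)
    (x y : TangentSpace (𝓡 (2 * n + 1)) p) :
    (S.gTransform u v w).g p x y
      = Real.exp (2 * u p) * Real.cos (2 * v p) * S.g p x y
        + Real.exp (2 * u p) * Real.sin (2 * v p) * S.g p x (S.φ p y)
        + (Real.exp (2 * w p) - Real.exp (2 * u p) * Real.cos (2 * v p))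
          * (S.η p x * S.η p y) := by
  simp [gTransform, associated]
  ring

/-- The Lie derivative of the transformed metric along a multiple of the Reeb field. -/
lemma IsF0.exists_lieDerivative_gTransform_eq (hS : S.IsF0) {u v w f : M → ℝ}
    (hu : ContMDiff (𝓡 (2 * n + 1)) 𝓘(ℝ, ℝ) ∞ u) (hv : ContMDiff (𝓡 (2 * n + 1)) 𝓘(ℝ, ℝ) ∞ v)
    (hw : ContMDiff (𝓡 (2 * n + 1)) 𝓘(ℝ, ℝ) ∞ w) (hf : ContMDiff (𝓡 (2 * n + 1)) 𝓘(ℝ, ℝ) ∞ f)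
    {ϑ : ∀ p : M, TangentSpace (𝓡 (2 * n + 1)) p} (hϑ : ∀ p, ϑ p = f p • S.ξ p) (p : M) :
    ∃ (c : ℝ) (μ : EuclideanSpace ℝ (Fin (2 * n + 1)) →L[ℝ] ℝ),
      ∀ a b : EuclideanSpace ℝ (Fin (2 * n + 1)),
      lieDerivative ϑ (S.gTransform u v w).g p a b
        = f p * (2 * (differential u p (S.ξ p) * (Real.exp (2 * u p) * Real.cos (2 * v p))
              - differential v p (S.ξ p) * (Real.exp (2 * u p) * Real.sin (2 * v p))) * S.g p a b
            + 2 * (differential u p (S.ξ p) * (Real.exp (2 * u p) * Real.sin (2 * v p))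
              + differential v p (S.ξ p) * (Real.exp (2 * u p) * Real.cos (2 * v p)))
              * S.g p a (S.φ p b)
            + c * (S.η p a * S.η p b))
          + μ a * (S.gTransform u v w).g p (S.ξ p) b
          + μ b * (S.gTransform u v w).g p a (S.ξ p) := by
  have du := differentiableAt_comp_extChartAt_symm (hu p)
  have dv := differentiableAt_comp_extChartAt_symm (hv p)
  have dw := differentiableAt_comp_extChartAt_symm (hw p)
  have df := differentiableAt_comp_extChartAt_symm (hf p)
  rw [differential_eq_fderiv ((hu p).mdifferentiableAt (by simp)),
    differential_eq_fderiv ((hv p).mdifferentiableAt (by simp))]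
  set U := fun y => u ((extChartAt (𝓡 (2 * n + 1)) p).symm y)
  set V := fun y => v ((extChartAt (𝓡 (2 * n + 1)) p).symm y)
  set W := fun y => w ((extChartAt (𝓡 (2 * n + 1)) p).symm y)
  set F := fun y => f ((extChartAt (𝓡 (2 * n + 1)) p).symm y)
  have hU₀ : U (extChartAt (𝓡 (2 * n + 1)) p p) = u p := congrArg u (extChartAt_to_inv p)
  have hV₀ : V (extChartAt (𝓡 (2 * n + 1)) p p) = v p := congrArg v (extChartAt_to_inv p)
  have hF₀ : F (extChartAt (𝓡 (2 * n + 1)) p p) = f p := congrArg f (extChartAt_to_inv p)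
  have hα := (du.hasFDerivAt.const_mul 2).exp.mul (dv.hasFDerivAt.const_mul 2).cos
  have hβ := (du.hasFDerivAt.const_mul 2).exp.mul (dv.hasFDerivAt.const_mul 2).sin
  have hγ : DifferentiableAt ℝ (fun y => Real.exp (2 * W y)
    - Real.exp (2 * U y) * Real.cos (2 * V y)) (extChartAt (𝓡 (2 * n + 1)) p p) := by fun_prop
  have key := (hS.isCosymplecticAt p).lieDerivForm_smul hα.differentiableAt hβ.differentiableAt
    hγ df (B := formInChart (S.gTransform u v w).g p) (Y := vectorInChart ϑ p)
    (by
      filter_upwards [extChartAt_target_eventually p] with y hy a b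
      simp only [formInChart_apply, chartFrame_vectorInChart S.ξ hy,
        chartFrame_endoInChart S.φ hy]
      refine (gTransform_g_apply S u v w _ _ _).trans ?_
      exact congrArg (HAdd.hAdd _) (congrArg (HMul.hMul _) (congrArg₂ HMul.hMul
        ((hS.isAccRSpace ((extChartAt (𝓡 (2 * n + 1)) p).symm y)).g_ξ (chartFrame M p y a)).symm
        ((hS.isAccRSpace ((extChartAt (𝓡 (2 * n + 1)) p).symm y)).g_ξ (chartFrame M p y b)).symm)))
    (Eventually.of_forall fun y => by
      rw [vectorInChart, hϑ]
      exact map_smul _ _ _)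
  let X : EuclideanSpace ℝ (Fin (2 * n + 1)) := S.ξ p
  let G : EuclideanSpace ℝ (Fin (2 * n + 1)) →L[ℝ] EuclideanSpace ℝ (Fin (2 * n + 1)) →L[ℝ] ℝ :=
    S.g p
  let H : EuclideanSpace ℝ (Fin (2 * n + 1)) →L[ℝ] ℝ := S.η p
  have hX : vectorInChart S.ξ p (extChartAt (𝓡 (2 * n + 1)) p p) = X := vectorInChart_self S.ξ p
  have hG : formInChart S.g p (extChartAt (𝓡 (2 * n + 1)) p p) = G := formInChart_self S.g p
  have hGX : ∀ a, G a X = H a := (hS.isAccRSpace p).g_ξ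
  simp only [endoInChart_self, formInChart_self (S.gTransform u v w).g, hX, hG, hα.fderiv,
    hβ.fderiv, hF₀, hU₀, hV₀, hGX, add_apply, smul_apply, smul_eq_mul] at key
  -- Regroups the output of the chain rule according to the derivative of `e^{2(u + iv)}`.
  have algebra : ∀ r e c s x y g₁ g₂ z m₁ m₂ : ℝ,
      r * ((e * (-s * (2 * y)) + c * (e * (2 * x))) * g₁
          + (e * (c * (2 * y)) + s * (e * (2 * x))) * g₂ + z) + m₁ + m₂
        = r * (2 * (x * (e * c) - y * (e * s)) * g₁ + 2 * (x * (e * s) + y * (e * c)) * g₂ + z)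
          + m₁ + m₂ := by
    intros
    ring
  -- The first witness is the derivative along `ξ` of the `η ⊗ η` coefficient. It needs no explicit
  -- form, because composition with `φ` kills it. The second is `df`.
  exact ⟨_, fderiv ℝ F (extChartAt (𝓡 (2 * n + 1)) p p),
    fun a b => (key a b).trans (algebra _ _ _ _ _ _ _ _ _ _ _)⟩

end AccRTensors

theorem mainTheorem8 (n : ℕ) (hn : 1 ≤ n)
    (M : Type*) [TopologicalSpace M] [ChartedSpace (EuclideanSpace ℝ (Fin (2 * n + 1))) M]
    [IsManifold (𝓡 (2 * n + 1)) ∞ M]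
    (S : AccRTensors n M) (hS : S.IsF0)
    (u v w : M → ℝ) (hu : ContMDiff (𝓡 (2 * n + 1)) 𝓘(ℝ, ℝ) ∞ u)
    (hv : ContMDiff (𝓡 (2 * n + 1)) 𝓘(ℝ, ℝ) ∞ v) (hw : ContMDiff (𝓡 (2 * n + 1)) 𝓘(ℝ, ℝ) ∞ w)
    (S' : AccRTensors n M) (hS' : S' = S.gTransform u v w)
    (ϑ : ∀ p : M, TangentSpace (𝓡 (2 * n + 1)) p) (σ k : M → ℝ)
    (hsol : TensorField.IsAlmostRiemannSoliton S'.g ϑ σ)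
    (hvert : S'.IsVerticalPotential ϑ k) :
    (∀ p, TensorField.starScalarCurvature S'.φ S'.g p =
      2 * n * (2 * n - 1) * k p * TensorField.differential v p (S'.ξ p)) ∧
    ((∀ p, TensorField.starScalarCurvature S'.φ S'.g p = 0) ↔
      ∀ p, TensorField.differential v p (S'.ξ p) = 0) := by
  subst hS'
  have main : ∀ p, TensorField.starScalarCurvature (S.gTransform u v w).φ (S.gTransform u v w).g p =
      2 * n * (2 * n - 1) * k p * TensorField.differential v p ((S.gTransform u v w).ξ p) := by
    intro p
    -- The potential is rewritten as a multiple of the original `ξ`, the field that is parallel for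
    -- `g`.
    have hf : ContMDiff (𝓡 (2 * n + 1)) 𝓘(ℝ, ℝ) ∞ (fun q => k q * Real.exp (-w q)) :=
      hvert.smooth_k.mul (Real.contDiff_exp.comp_contMDiff hw.neg)
    have hϑ : ∀ q, ϑ q = (k q * Real.exp (-w q)) • S.ξ q := fun q => by
      rw [hvert.eq_smul q, mul_smul]
      rfl
    obtain ⟨c, μ, hL⟩ := hS.exists_lieDerivative_gTransform_eq hu hv hw hf hϑ p
    obtain ⟨B, hB⟩ := InChart.exists_form_eq_lieDerivForm
      (TensorField.formInChart (S.gTransform u v w).g p) (TensorField.vectorInChart ϑ p)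
      (extChartAt (𝓡 (2 * n + 1)) p p)
    have hαβ : (Real.exp (2 * u p) * Real.cos (2 * v p)) ^ 2
        + (Real.exp (2 * u p) * Real.sin (2 * v p)) ^ 2 ≠ 0 := by
      have : (Real.exp (2 * u p) * Real.cos (2 * v p)) ^ 2
          + (Real.exp (2 * u p) * Real.sin (2 * v p)) ^ 2 = Real.exp (2 * u p) ^ 2 := by
        linear_combination Real.exp (2 * u p) ^ 2 * Real.sin_sq_add_cos_sq (2 * v p)
      rw [this]
      positivity
    have key := (hS.isAccRSpace p).metricTrace_metricTrace_contactConformal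
      (S.gTransform_g_apply u v w p) hαβ (Real.exp_ne_zero (2 * w p))
      (fun a b => (hB a b).symm.trans (hL a b))
      (R := TensorField.riemannTensor (S.gTransform u v w).g p) (σ := σ p)
      (fun x y z t => by
        have := hsol.soliton_eq p x y z t
        have hLB : TensorField.lieDerivative ϑ (S.gTransform u v w).g p = fun a b => B a b :=
          funext fun a => funext fun b => hB a b
        rwa [hLB] at this)
    refine (show _ = _ from key).trans ?_
    have hξ : TensorField.differential v p ((S.gTransform u v w).ξ p)
        = Real.exp (-w p) * TensorField.differential v p (S.ξ p) := by
      exact map_smul (mfderiv (𝓡 (2 * n + 1)) 𝓘(ℝ, ℝ) v p) _ _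
    rw [hξ]
    ring
  refine ⟨main, forall_congr' fun p => ?_⟩
  -- For `n ≥ 1` the factor `2n(2n - 1)` is nonzero and `k` never vanishes, so both sides of the
  -- formula vanish together.
  have hn' : (2 * n * (2 * n - 1) : ℝ) ≠ 0 := by
    have : (1 : ℝ) ≤ n := by exact_mod_cast hn
    exact mul_ne_zero (by linarith) (by linarith)
  rw [main p, mul_eq_zero, mul_eq_zero]
  simp [hn', hvert.k_ne_zero p]
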